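/- Let $\lambda_{\mathrm p}>0$, $m>0$, $r_{\mathrm d}>0$, $R>0$, $r_{\mathsf K}\ge 0$, and put $\lambda_{\mathrm d}=\dfrac{m}{\pi r_{\mathrm d}^2}$, $r=R+r_{\mathsf K}$. Let $\Phi$ be a Matérn cluster process in $\mathbb R^2$: the parent points $\{\mathbf x_i\}$ form a homogeneous Poisson point process of intensity $\lambda_{\mathrm p}$; the daughter processes $\Phi_{\mathrm d}^{(i)}$, $i\in\mathbb N$, are i.i.d., independent of the parents, and each is a Poisson point process with constant intensity $\lambda_{\mathrm d}$ on the disc $\mathcal B(\mathrm o,r_{\mathrm d})$ (and no points outside it), so that it has $m$ points on average; and $\Phi=\bigcup_i(\mathbf x_i+\Phi_{\mathrm d}^{(i)})$. Let $\Psi=\bigcup_{\mathbf z\in\Phi}\mathcal B(\mathbf z,R)$ be the associated Boolean model, and let $$T=\mathbb P\big(\Psi\cap\mathcal B(\mathrm o,r_{\mathsf K})\ne\emptyset\big)$$ be its capacity functional at the closed disc $\mathcal B(\mathrm o,r_{\mathsf K})$. Write $\operatorname{erf}(x)=\frac{2}{\sqrt\pi}\int_0^x e^{-t^2}\,dt$,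 $\beta=\beta(r)=\min(r,r_{\mathrm d})$ and $$A=(r-r_{\mathrm d})^2\left(1-e^{-\lambda_{\mathrm d}\pi\beta^2}\right)+4\,r\,r_{\mathrm d}.$$ Then $L_2\le T\le U$ and $L_4\le T$, where $$U=1-\exp(-\pi\lambda_{\mathrm p}A)\,\exp\!\left(\frac{\pi\lambda_{\mathrm p}}{2\lambda_{\mathrm d}^2\beta^2}\left[-1+2\lambda_{\mathrm d}\beta\left(r+r_{\mathrm d}-|r-r_{\mathrm d}|\,e^{-4\lambda_{\mathrm d}\beta^2}\right)+e^{-4\lambda_{\mathrm d}\beta^2}\right]\right)$$ and, for $c\in\{2,4\}$, $$L_c=1-\exp(-\pi\lambda_{\mathrm p}A)\,\exp\!\left(\frac{c\,\lambda_{\mathrm p}}{\lambda_{\mathrm d}}\left[-2+2e^{-\lambda_{\mathrm d}\pi\beta^2}-\pi\sqrt{\lambda_{\mathrm d}}\,(r+r_{\mathrm d})\operatorname{erf}\!\left(-\sqrt{\lambda_{\mathrm d}\pi}\,\beta\right)\right]\right).$$ -/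

import Mathlib

open MeasureTheory ProbabilityTheory
open scoped ENNReal

noncomputable section

/-- The plane `ℝ²` with its Euclidean norm and Lebesgue measure. -/
abbrev Plane : Type := EuclideanSpace ℝ (Fin 2)

/-- The error function `erf x = (2 / √π) ∫₀ˣ exp (-t²) dt`. -/
def erf (x : ℝ) : ℝ := 2 / √Real.pi * ∫ t in (0 : ℝ)..x, Real.exp (-t ^ 2)

/-- A point process on `E`, given by a measurable enumeration `pt 0, pt 1, …` of its points;
`num` is the (possibly infinite) number of points, so only the indices `j < num ω` count. -/
structure PointProcess (Ω E : Type*) [MeasurableSpace Ω] [MeasurableSpace E] where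
  num : Ω → ℕ∞
  pt : ℕ → Ω → E
  measurable_num : Measurable num
  measurable_pt : ∀ j, Measurable (pt j)

namespace PointProcess

variable {Ω E : Type*} [MeasurableSpace Ω] [MeasurableSpace E]

/-- The set of points of the process. -/
def points (N : PointProcess Ω E) (ω : Ω) : Set E :=
  {z | ∃ j : ℕ, (j : ℕ∞) < N.num ω ∧ N.pt j ω = z}

open Classical in
/-- The random counting measure of the process: `N.count ω B` is the number of points in `B`. -/
def count (N : PointProcess Ω E) (ω : Ω) : Measure E :=
  Measure.sum fun j : ℕ => if (j : ℕ∞) < N.num ω then Measure.dirac (N.pt j ω) else 0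

/-- `N` is a Poisson point process with intensity measure `Λ`: the number of points in a
measurable set `B` with `Λ B < ∞` is Poisson distributed with mean `Λ B`, and the numbers of
points in finitely many pairwise disjoint such sets are independent. -/
structure IsPoisson (N : PointProcess Ω E) (Λ : Measure E) (P : Measure Ω) : Prop where
  law : ∀ B : Set E, MeasurableSet B → Λ B ≠ ∞ → ∀ k : ℕ,
    P {ω | N.count ω B = (k : ℝ≥0∞)} =
      ENNReal.ofReal (Real.exp (-(Λ B).toReal) * (Λ B).toReal ^ k / (Nat.factorial k : ℝ))
  indep : ∀ (n : ℕ) (B : Fin n → Set E), (∀ i, MeasurableSet (B i)) → (∀ i, Λ (B i) ≠ ∞) →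
    (∀ i j, i ≠ j → Disjoint (B i) (B j)) → iIndepFun (fun i ω => N.count ω (B i)) P

end PointProcess

/-- The set of all points `x i + y` with `x i` the `i`-th parent point and `y` a point of the
`i`-th daughter process. -/
def clusterPoints {Ω : Type*} [MeasurableSpace Ω] (parent : PointProcess Ω Plane)
    (daughter : ℕ → PointProcess Ω Plane) (ω : Ω) : Set Plane :=
  {z | ∃ i : ℕ, (i : ℕ∞) < parent.num ω ∧
    ∃ y ∈ (daughter i).points ω, z = parent.pt i ω + y}

/-- The data of a Matérn cluster process: the parents form a homogeneous Poisson process of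
intensity `lp`, the daughter processes are i.i.d. Poisson processes with constant intensity
`m / (π rd²)` on the disc of radius `rd` about the origin, independent of the parents. -/
structure IsMaternCluster {Ω : Type*} [MeasurableSpace Ω] (parent : PointProcess Ω Plane)
    (daughter : ℕ → PointProcess Ω Plane) (lp m rd : ℝ) (P : Measure Ω) : Prop where
  parent_poisson : parent.IsPoisson (ENNReal.ofReal lp • (volume : Measure Plane)) P
  daughter_poisson : ∀ i, (daughter i).IsPoisson
    (ENNReal.ofReal (m / (Real.pi * rd ^ 2)) •
      (volume : Measure Plane).restrict (Metric.closedBall 0 rd)) P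
  indep_daughters : iIndepFun (fun i ω => (daughter i).count ω) P
  indep_parent : IndepFun (fun ω => (parent.num ω, fun i => parent.pt i ω))
    (fun ω i => (daughter i).count ω) P

/-- The region covered by discs of radius `R` centred at the points of `Z`. -/
def coveredRegion (Z : Set Plane) (R : ℝ) : Set Plane :=
  ⋃ z ∈ Z, Metric.closedBall z R

/-- The capacity functional `T_Ψ(K) = P(Ψ ∩ K ≠ ∅)` of a random set `Ψ`. -/
def capacityFunctional {Ω : Type*} [MeasurableSpace Ω] (P : Measure Ω) (Ψ : Ω → Set Plane)
    (K : Set Plane) : ℝ :=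
  (P {ω | (Ψ ω ∩ K).Nonempty}).toReal

/-- `β(r) = min (r, rd)`. -/
def betaMin (r rd : ℝ) : ℝ := min r rd

/-- `A = (r - rd)² (1 - exp (-ld π β(r)²)) + 4 r rd`. -/
def aTerm (r rd ld : ℝ) : ℝ :=
  (r - rd) ^ 2 * (1 - Real.exp (-(ld * Real.pi * betaMin r rd ^ 2))) + 4 * r * rd

/-- The closed-form upper bound. -/
def maternUpper (lp ld r rd : ℝ) : ℝ :=
  1 - Real.exp (-(Real.pi * lp * aTerm r rd ld)) *
    Real.exp (Real.pi * lp / (2 * ld ^ 2 * betaMin r rd ^ 2) *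
      (-1 + 2 * ld * betaMin r rd *
          (r + rd - |r - rd| * Real.exp (-(4 * ld * betaMin r rd ^ 2)))
        + Real.exp (-(4 * ld * betaMin r rd ^ 2))))

/-- The closed-form lower bound, with the numerical constant `c` in front of `lp / ld`. -/
def maternLower (c lp ld r rd : ℝ) : ℝ :=
  1 - Real.exp (-(Real.pi * lp * aTerm r rd ld)) *
    Real.exp (c * lp / ld *
      (-2 + 2 * Real.exp (-(ld * Real.pi * betaMin r rd ^ 2))
        - Real.pi * √ld * (r + rd) * erf (-(√(ld * Real.pi) * betaMin r rd))))

end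

open Filter Topology

/-! The Boolean model misses the disc of radius `rK` exactly when no cluster point lies in the disc
of radius `r = R + rK`, so the capacity is one minus a void probability. With the parents frozen,
the independent daughters miss that disc with probability `∏ exp (-g (x i))`, where `g x` is the
daughter intensity times the area of the lens cut by the discs of radii `r` about `-x` and `rd`
about `0`. Averaging over the parents by the Poisson Laplace functional (`lintegral_expNeg`) gives
`exp (-lp ∫ (1 - exp (-g)))`; this is `IsMaternCluster.measure_void`.

The bounds come from the lens area alone. For `‖x‖ ≤ |r - rd|` it is exactly `π β²`, and beyond `r +
rd` it vanishes. In between, the lens of width `s = r + rd - ‖x‖` contains a disc of diameter `s`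
(`le_volume_lens`) and fits in an `s × 2β` rectangle (`volume_lens_le`). Both estimates are radial,
and polar coordinates (`integral_annularProfile_norm`) turn them into elementary integrals that
produce `maternLower 2` and `maternUpper`. The constant 4 only weakens the lower bound. -/

/-! ### The exponential on `[0, ∞]` -/

/-- The decreasing exponential `t ↦ exp (-t)` on `[0, ∞]`. -/
noncomputable def expNeg (t : ℝ≥0∞) : ℝ≥0∞ := (EReal.exp (t : EReal))⁻¹

lemma expNeg_zero : expNeg 0 = 1 := by simp [expNeg]

lemma one_le_exp_coe (t : ℝ≥0∞) : 1 ≤ EReal.exp (t : EReal) := by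
  rw [EReal.one_le_exp_iff]; exact EReal.coe_ennreal_nonneg t

lemma expNeg_add (s t : ℝ≥0∞) : expNeg (s + t) = expNeg s * expNeg t := by
  have hs := (zero_lt_one.trans_le (one_le_exp_coe s)).ne'
  have ht := (zero_lt_one.trans_le (one_le_exp_coe t)).ne'
  rw [expNeg, EReal.coe_ennreal_add, EReal.exp_add, ENNReal.mul_inv (Or.inl hs) (Or.inr ht)]
  rfl

lemma continuous_expNeg : Continuous expNeg :=
  continuous_inv.comp (ENNReal.continuous_exp.comp continuous_coe_ennreal_ereal)

lemma measurable_expNeg : Measurable expNeg := continuous_expNeg.measurable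

lemma expNeg_le_one (t : ℝ≥0∞) : expNeg t ≤ 1 := by
  rw [expNeg, ENNReal.inv_le_one]; exact one_le_exp_coe t

lemma expNeg_antitone : Antitone expNeg := by
  intro s t h
  rw [expNeg, expNeg, ENNReal.inv_le_inv, EReal.exp_le_exp_iff]
  exact_mod_cast h

lemma expNeg_ofReal {x : ℝ} (hx : 0 ≤ x) :
    expNeg (ENNReal.ofReal x) = ENNReal.ofReal (Real.exp (-x)) := by
  rw [expNeg, EReal.coe_ennreal_ofReal, max_eq_left hx, EReal.exp_coe, Real.exp_neg,
    ENNReal.ofReal_inv_of_pos (Real.exp_pos x)]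

lemma expNeg_sum {ι : Type*} (s : Finset ι) (f : ι → ℝ≥0∞) :
    expNeg (∑ i ∈ s, f i) = ∏ i ∈ s, expNeg (f i) := by
  classical
  induction s using Finset.induction_on with
  | empty => simp [expNeg_zero]
  | insert a s ha ih => rw [Finset.sum_insert ha, Finset.prod_insert ha, expNeg_add, ih]

lemma expNeg_mul_natCast (c : ℝ≥0∞) (k : ℕ) : expNeg (c * k) = expNeg c ^ k := by
  induction k with
  | zero => simp [expNeg_zero]
  | succ k ih => rw [Nat.cast_succ, mul_add, mul_one, expNeg_add, ih, pow_succ]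

/-- The Poisson generating function: `q = 1` gives total mass one, `q = exp (-c)` the Laplace
transform. -/
lemma tsum_ofReal_poisson (l q : ℝ) (hl : 0 ≤ l) (hq : 0 ≤ q) :
    ∑' k : ℕ, ENNReal.ofReal q ^ k * ENNReal.ofReal (Real.exp (-l) * l ^ k / (k.factorial : ℝ)) =
      ENNReal.ofReal (Real.exp (-l * (1 - q))) := by
  have h := (NormedSpace.expSeries_div_hasSum_exp (l * q)).mul_left (Real.exp (-l))
  rw [← Real.exp_eq_exp_ℝ] at h
  have e : Real.exp (-l * (1 - q)) = Real.exp (-l) * Real.exp (l * q) := by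
    rw [← Real.exp_add]; ring_nf
  rw [e, ← h.tsum_eq, ENNReal.ofReal_tsum_of_nonneg (fun k => by positivity) h.summable]
  refine tsum_congr fun k => ?_
  rw [← ENNReal.ofReal_pow hq, ← ENNReal.ofReal_mul (by positivity), mul_pow]
  ring_nf

/-! ### Laplace transform of a Poisson variable -/

section PoissonVariable

variable {Ω : Type*} [MeasurableSpace Ω] {P : Measure Ω} [IsProbabilityMeasure P]

lemma ae_exists_natCast_of_poisson {X : Ω → ℝ≥0∞} (hX : Measurable X) {l : ℝ} (hl : 0 ≤ l)
    (h : ∀ k : ℕ, P {ω | X ω = k} = ENNReal.ofReal (Real.exp (-l) * l ^ k / (k.factorial : ℝ))) :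
    ∀ᵐ ω ∂P, ω ∈ ⋃ k : ℕ, {ω | X ω = k} := by
  have hm : ∀ k : ℕ, MeasurableSet {ω | X ω = k} := fun k => hX (measurableSet_singleton _)
  have hd : Pairwise (Function.onFun Disjoint fun k : ℕ => {ω | X ω = k}) := by
    intro i j hij
    refine Set.disjoint_left.2 fun ω h1 h2 => hij ?_
    have : (i : ℝ≥0∞) = j := h1.symm.trans h2
    exact_mod_cast this
  have := tsum_ofReal_poisson l 1 hl zero_le_one
  simp only [ENNReal.ofReal_one, one_pow, one_mul, sub_self, mul_zero, Real.exp_zero] at this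
  refine (mem_ae_iff_prob_eq_one (MeasurableSet.iUnion hm)).2 ?_
  rw [measure_iUnion hd hm]
  simp_rw [h, this]

lemma lintegral_expNeg_mul_of_poisson {X : Ω → ℝ≥0∞} (hX : Measurable X) {L : ℝ≥0∞} (hL : L ≠ ∞)
    (h : ∀ k : ℕ, P {ω | X ω = k} =
      ENNReal.ofReal (Real.exp (-L.toReal) * L.toReal ^ k / (k.factorial : ℝ))) (c : ℝ≥0∞) :
    ∫⁻ ω, expNeg (c * X ω) ∂P = expNeg ((1 - expNeg c) * L) := by
  have hm : ∀ k : ℕ, MeasurableSet {ω | X ω = k} := fun k => hX (measurableSet_singleton _)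
  have hd : Pairwise (Function.onFun Disjoint fun k : ℕ => {ω | X ω = k}) := by
    intro i j hij
    refine Set.disjoint_left.2 fun ω h1 h2 => hij ?_
    have : (i : ℝ≥0∞) = j := h1.symm.trans h2
    exact_mod_cast this
  have hae := ae_exists_natCast_of_poisson hX ENNReal.toReal_nonneg h
  have hu : P.restrict (⋃ k : ℕ, {ω | X ω = k}) = P := Measure.restrict_eq_self_of_ae_mem hae
  have hq : expNeg c ≠ ∞ := ((expNeg_le_one c).trans_lt ENNReal.one_lt_top).ne
  have hq1 : (expNeg c).toReal ≤ 1 := ENNReal.toReal_le_of_le_ofReal zero_le_one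
    (by simpa using expNeg_le_one c)
  rw [← hu, lintegral_iUnion hm hd]
  have key : ∀ k : ℕ, ∫⁻ ω in {ω | X ω = k}, expNeg (c * X ω) ∂P =
      ENNReal.ofReal (expNeg c).toReal ^ k *
        ENNReal.ofReal (Real.exp (-L.toReal) * L.toReal ^ k / (k.factorial : ℝ)) := by
    intro k
    rw [setLIntegral_congr_fun (g := fun _ => expNeg c ^ k) (hm k), lintegral_const,
      Measure.restrict_apply_univ, h, ENNReal.ofReal_toReal hq]
    intro ω hω
    have hω : X ω = k := hω
    simp only [hω, expNeg_mul_natCast]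
  simp_rw [key]
  rw [tsum_ofReal_poisson _ _ ENNReal.toReal_nonneg ENNReal.toReal_nonneg]
  have : (1 - expNeg c) * L = ENNReal.ofReal (L.toReal * (1 - (expNeg c).toReal)) := by
    rw [ENNReal.ofReal_mul ENNReal.toReal_nonneg, ENNReal.ofReal_toReal hL,
      ENNReal.ofReal_sub _ ENNReal.toReal_nonneg, ENNReal.ofReal_toReal hq, ENNReal.ofReal_one,
      mul_comm]
  rw [this, expNeg_ofReal (mul_nonneg ENNReal.toReal_nonneg (by linarith)), neg_mul]

end PoissonVariable

/-! ### Counting measures and the Poisson Laplace functional -/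

namespace PointProcess

variable {Ω E : Type*} [MeasurableSpace Ω] [MeasurableSpace E]

lemma measurableSet_lt_num (N : PointProcess Ω E) (j : ℕ) :
    MeasurableSet {ω | (j : ℕ∞) < N.num ω} :=
  N.measurable_num (Set.to_countable (Set.Ioi (j : ℕ∞))).measurableSet

open Classical in
lemma lintegral_count (N : PointProcess Ω E) (ω : Ω) {f : E → ℝ≥0∞} (hf : Measurable f) :
    ∫⁻ x, f x ∂(N.count ω) = ∑' j : ℕ, if (j : ℕ∞) < N.num ω then f (N.pt j ω) else 0 := by
  rw [count, lintegral_sum_measure]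
  refine tsum_congr fun j => ?_
  split_ifs
  · rw [lintegral_dirac' _ hf]
  · simp

lemma measurable_count (N : PointProcess Ω E) : Measurable N.count := by
  classical
  refine Measure.measurable_of_measurable_coe _ fun s hs => ?_
  have h : ∀ ω, N.count ω s =
      ∑' j : ℕ, if (j : ℕ∞) < N.num ω then s.indicator 1 (N.pt j ω) else 0 := by
    intro ω
    rw [← lintegral_count N ω (measurable_one.indicator hs), lintegral_indicator_one hs]
  simp_rw [h]
  refine Measurable.tsum fun j => ?_
  exact Measurable.ite (N.measurableSet_lt_num j)
    ((measurable_one.indicator hs).comp (N.measurable_pt j)) measurable_const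

lemma count_eq_zero_iff (N : PointProcess Ω E) (ω : Ω) {s : Set E} (hs : MeasurableSet s) :
    N.count ω s = 0 ↔ ∀ j : ℕ, (j : ℕ∞) < N.num ω → N.pt j ω ∉ s := by
  classical
  rw [← lintegral_indicator_one hs, lintegral_count N ω (measurable_one.indicator hs),
    ENNReal.tsum_eq_zero]
  refine forall_congr' fun j => ?_
  by_cases h : (j : ℕ∞) < N.num ω <;> simp [h]

namespace IsPoisson

variable {N : PointProcess Ω E} {Λ : Measure E} {P : Measure Ω}

lemma measure_count_eq_zero (h : N.IsPoisson Λ P) {B : Set E} (hB : MeasurableSet B)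
    (hΛ : Λ B ≠ ∞) : P {ω | N.count ω B = 0} = expNeg (Λ B) := by
  have := h.law B hB hΛ 0
  simp only [Nat.cast_zero, pow_zero, mul_one, Nat.factorial_zero, Nat.cast_one, div_one] at this
  rw [this, ← expNeg_ofReal ENNReal.toReal_nonneg, ENNReal.ofReal_toReal hΛ]

lemma ae_count_ne_top [IsProbabilityMeasure P] (h : N.IsPoisson Λ P) {B : Set E}
    (hB : MeasurableSet B) (hΛ : Λ B ≠ ∞) : ∀ᵐ ω ∂P, N.count ω B ≠ ∞ := by
  filter_upwards [ae_exists_natCast_of_poisson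
    ((Measure.measurable_coe hB).comp N.measurable_count) ENNReal.toReal_nonneg
    (h.law B hB hΛ)] with ω hω
  obtain ⟨k, hk⟩ := Set.mem_iUnion.1 hω
  have hk : N.count ω B = k := hk
  rw [hk]
  exact ENNReal.natCast_ne_top k

/-- The integral against the counting measure is `∑ c · N (f = c)`. The fibres are disjoint, so the
counts are independent and the expectation factors into Poisson Laplace transforms. -/
lemma lintegral_expNeg_simpleFunc [IsProbabilityMeasure P] (h : N.IsPoisson Λ P)
    (f : SimpleFunc E ℝ≥0∞) (hf : Λ {x | f x ≠ 0} ≠ ∞) :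
    ∫⁻ ω, expNeg (∫⁻ x, f x ∂(N.count ω)) ∂P = expNeg (∫⁻ x, (1 - expNeg (f x)) ∂Λ) := by
  classical
  -- The zero fibre is discarded: it contributes nothing, and its intensity may be infinite, where
  -- the Poisson law says nothing.
  set S := f.range.filter (· ≠ 0) with hS
  have hsub : ∀ c ∈ S, f ⁻¹' {c} ⊆ {x | f x ≠ 0} := by
    intro c hc x hx
    have hx : f x = c := hx
    have := (Finset.mem_filter.1 hc).2
    simpa [hx] using this
  have hfin : ∀ c ∈ S, Λ (f ⁻¹' {c}) ≠ ∞ := fun c hc =>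
    ((measure_mono (hsub c hc)).trans_lt hf.lt_top).ne
  have hX : ∀ c : ℝ≥0∞, Measurable fun ω => N.count ω (f ⁻¹' {c}) := fun c =>
    (Measure.measurable_coe (f.measurableSet_fiber c)).comp N.measurable_count
  have e1 : ∀ ω, expNeg (∫⁻ x, f x ∂(N.count ω)) =
      ∏ c : S, expNeg (c * N.count ω (f ⁻¹' {(c : ℝ≥0∞)})) := by
    intro ω
    rw [← expNeg_sum, Finset.sum_coe_sort S fun c => c * N.count ω (f ⁻¹' {c}),
      SimpleFunc.lintegral_eq_lintegral, SimpleFunc.lintegral, hS, Finset.sum_filter_of_ne]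
    intro c _ hc h0
    simp [h0] at hc
  have e2 : ∫⁻ x, (1 - expNeg (f x)) ∂Λ = ∑ c : S, (1 - expNeg c) * Λ (f ⁻¹' {(c : ℝ≥0∞)}) := by
    have : ∫⁻ x, (1 - expNeg (f x)) ∂Λ = ∫⁻ x, (f.map fun c => 1 - expNeg c) x ∂Λ := rfl
    rw [this, SimpleFunc.lintegral_eq_lintegral, SimpleFunc.map_lintegral,
      Finset.sum_coe_sort S fun c => (1 - expNeg c) * Λ (f ⁻¹' {c}), hS, Finset.sum_filter_of_ne]
    intro c _ hc h0
    simp [h0, expNeg_zero] at hc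
  have hind : iIndepFun (fun (c : S) ω => N.count ω (f ⁻¹' {(c : ℝ≥0∞)})) P := by
    have e := Fintype.equivFin S
    have := h.indep (Fintype.card S) (fun i => f ⁻¹' {((e.symm i : S) : ℝ≥0∞)})
      (fun i => f.measurableSet_fiber _) (fun i => hfin _ (e.symm i).2) (fun i j hij => by
        refine Disjoint.preimage _ (Set.disjoint_singleton.2 fun hc => hij ?_)
        exact e.symm.injective (Subtype.ext hc))
    simpa using this.precomp e.injective
  have hind2 : iIndepFun (fun (c : S) ω => expNeg (c * N.count ω (f ⁻¹' {(c : ℝ≥0∞)}))) P :=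
    hind.comp (fun c t => expNeg (c * t))
      (fun c => measurable_expNeg.comp (measurable_id.const_mul _))
  simp_rw [e1]
  rw [lintegral_prod_eq_prod_lintegral_of_indepFun _ _ hind2
    (fun c => measurable_expNeg.comp ((hX c).const_mul _)), e2, expNeg_sum]
  refine Finset.prod_congr rfl fun c _ => ?_
  exact lintegral_expNeg_mul_of_poisson (hX c) (hfin _ c.2)
    (h.law _ (f.measurableSet_fiber _) (hfin _ c.2)) _

/-- The Laplace functional of a Poisson point process. -/
theorem lintegral_expNeg [IsProbabilityMeasure P] (h : N.IsPoisson Λ P)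
    {g : E → ℝ≥0∞} (hg : Measurable g) (hΛ : Λ {x | g x ≠ 0} ≠ ∞) :
    ∫⁻ ω, expNeg (∫⁻ x, g x ∂(N.count ω)) ∂P = expNeg (∫⁻ x, (1 - expNeg (g x)) ∂Λ) := by
  have hmono : ∀ x, Monotone fun n => SimpleFunc.eapprox g n x := fun x n m hnm =>
    SimpleFunc.monotone_eapprox g hnm x
  have hle : ∀ n x, SimpleFunc.eapprox g n x ≤ g x := fun n x =>
    (hmono x).ge_of_tendsto (SimpleFunc.tendsto_eapprox hg x) n
  have hsimple : ∀ n, _ := fun n => h.lintegral_expNeg_simpleFunc (SimpleFunc.eapprox g n)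
    ((measure_mono (t := {x | g x ≠ 0}) (fun x (hx : _ ≠ _) (h0 : g x = 0) =>
      hx (le_antisymm ((hle n x).trans h0.le) bot_le))).trans_lt hΛ.lt_top).ne
  -- The left side decreases in `n`, so its limit uses domination by 1; on the right, `1 - expNeg`
  -- increases and monotone convergence applies.
  have t1 : Tendsto (fun n => ∫⁻ ω, expNeg (∫⁻ x, SimpleFunc.eapprox g n x ∂(N.count ω)) ∂P) atTop
      (𝓝 (∫⁻ ω, expNeg (∫⁻ x, g x ∂(N.count ω)) ∂P)) := by
    refine tendsto_lintegral_of_dominated_convergence (fun _ => 1) (fun n => ?_)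
      (fun n => ae_of_all _ fun ω => expNeg_le_one _) (by simp) (ae_of_all _ fun ω => ?_)
    · exact measurable_expNeg.comp
        ((Measure.measurable_lintegral (SimpleFunc.measurable _)).comp N.measurable_count)
    · refine (continuous_expNeg.tendsto _).comp ?_
      exact lintegral_tendsto_of_tendsto_of_monotone
        (fun n => (SimpleFunc.measurable _).aemeasurable) (ae_of_all _ hmono)
        (ae_of_all _ (SimpleFunc.tendsto_eapprox hg))
  have t2 : Tendsto (fun n => expNeg (∫⁻ x, (1 - expNeg (SimpleFunc.eapprox g n x)) ∂Λ)) atTop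
      (𝓝 (expNeg (∫⁻ x, (1 - expNeg (g x)) ∂Λ))) := by
    refine (continuous_expNeg.tendsto _).comp ?_
    refine lintegral_tendsto_of_tendsto_of_monotone (fun n => ?_)
      (ae_of_all _ fun x n m hnm => tsub_le_tsub_left (expNeg_antitone (hmono x hnm)) 1)
      (ae_of_all _ fun x => ?_)
    · exact (measurable_const.sub
        (measurable_expNeg.comp (SimpleFunc.measurable _))).aemeasurable
    · exact ENNReal.Tendsto.sub tendsto_const_nhds
        ((continuous_expNeg.tendsto _).comp (SimpleFunc.tendsto_eapprox hg x))
        (Or.inl ENNReal.one_ne_top)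
  simp_rw [hsimple] at t1
  exact tendsto_nhds_unique t1 t2

end IsPoisson

end PointProcess

/-! ### Joint measurability of null sections -/

section FiniteSections

variable {α β : Type*} [MeasurableSpace α] [MeasurableSpace β]

/-- Truncated evaluation kernel: a measure of total mass at most `n` is kept, others are dropped. -/
noncomputable def truncKernel (α β : Type*) [MeasurableSpace α] [MeasurableSpace β] (n : ℕ) :
    Kernel (α × Measure β) β :=
  open Classical in
  { toFun := fun p => if p.2 Set.univ ≤ n then p.2 else 0
    measurable' := Measurable.ite
      (((Measure.measurable_coe MeasurableSet.univ).comp measurable_snd) measurableSet_Iic)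
      measurable_snd measurable_const }

lemma truncKernel_apply_of_le {n : ℕ} {p : α × Measure β} (h : p.2 Set.univ ≤ n) :
    truncKernel α β n p = p.2 := if_pos h

lemma truncKernel_apply_of_not_le {n : ℕ} {p : α × Measure β} (h : ¬ p.2 Set.univ ≤ n) :
    truncKernel α β n p = 0 := if_neg h

instance isFiniteKernel_truncKernel (n : ℕ) : IsFiniteKernel (truncKernel α β n) := by
  refine ⟨⟨n, ENNReal.natCast_lt_top n, fun p => ?_⟩⟩
  by_cases h : p.2 Set.univ ≤ n
  · rwa [truncKernel_apply_of_le h]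
  · simp [truncKernel_apply_of_not_le h]

/-- Whether a finite measure gives no mass to a section of a measurable set depends measurably
on both the measure and the section. -/
lemma measurableSet_section_null {t : Set (α × β)} (ht : MeasurableSet t) :
    MeasurableSet {p : α × Measure β | p.2 Set.univ ≠ ∞ → p.2 (Prod.mk p.1 ⁻¹' t) = 0} := by
  have ht' : MeasurableSet {q : (α × Measure β) × β | (q.1.1, q.2) ∈ t} :=
    ((measurable_fst.comp measurable_fst).prodMk measurable_snd) ht
  -- Section measurability is available for finite kernels; each finite measure survives some
  -- truncation, and infinite ones become zero in all of them.
  have e : {p : α × Measure β | p.2 Set.univ ≠ ∞ → p.2 (Prod.mk p.1 ⁻¹' t) = 0} =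
      ⋂ n : ℕ, {p | truncKernel α β n p (Prod.mk p ⁻¹' {q | (q.1.1, q.2) ∈ t}) = 0} := by
    ext p
    simp only [Set.mem_ofPred_eq, Set.mem_iInter]
    constructor
    · intro h n
      by_cases hn : p.2 Set.univ ≤ n
      · rw [truncKernel_apply_of_le hn]
        exact h (hn.trans_lt (ENNReal.natCast_lt_top n)).ne
      · simp [truncKernel_apply_of_not_le hn]
    · intro h hp
      obtain ⟨n, hn⟩ := ENNReal.exists_nat_gt hp
      have := h n
      rwa [truncKernel_apply_of_le hn.le] at this
  rw [e]
  exact MeasurableSet.iInter fun n =>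
    (Kernel.measurable_kernel_prodMk_left ht') (measurableSet_singleton _)

end FiniteSections

/-- Finite intersections factor and decrease to the full event; writing the factors as `expNeg (a
i)` turns the infinite product into a sum. -/
lemma measure_forall_mem_of_iIndepFun {Ω β : Type*} [MeasurableSpace Ω] [MeasurableSpace β]
    {P : Measure Ω} [IsProbabilityMeasure P] {D : ℕ → Ω → β} (hD : iIndepFun D P)
    (hm : ∀ i, Measurable (D i)) {A : ℕ → Set β} (hA : ∀ i, MeasurableSet (A i))
    {a : ℕ → ℝ≥0∞} (ha : ∀ i, P (D i ⁻¹' A i) = expNeg (a i)) :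
    P {ω | ∀ i, D i ω ∈ A i} = expNeg (∑' i, a i) := by
  have hmono : Antitone fun n => ⋂ i ∈ Finset.range n, D i ⁻¹' A i := fun n m hnm =>
    Set.biInter_subset_biInter_left (by simpa using hnm)
  have hmeas : ∀ n, MeasurableSet (⋂ i ∈ Finset.range n, D i ⁻¹' A i) := fun n =>
    Finset.measurableSet_biInter _ fun i _ => hm i (hA i)
  have t1 := tendsto_measure_iInter_atTop (μ := P) (fun n => (hmeas n).nullMeasurableSet) hmono
    ⟨0, measure_ne_top _ _⟩
  have e : (⋂ n, ⋂ i ∈ Finset.range n, D i ⁻¹' A i) = {ω | ∀ i, D i ω ∈ A i} := by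
    ext ω
    simp only [Finset.mem_range, Set.mem_iInter, Set.mem_preimage, Set.mem_ofPred_eq]
    exact ⟨fun h i => h (i + 1) i (Nat.lt_succ_self i), fun h n i _ => h i⟩
  have e2 : (P ∘ fun n => ⋂ i ∈ Finset.range n, D i ⁻¹' A i) =
      fun n => expNeg (∑ i ∈ Finset.range n, a i) := by
    funext n
    rw [Function.comp_apply, hD.measure_inter_preimage_eq_mul _ (fun i _ => hA i), expNeg_sum]
    exact Finset.prod_congr rfl fun i _ => ha i
  rw [e, e2] at t1
  exact tendsto_nhds_unique t1
    ((continuous_expNeg.tendsto _).comp (ENNReal.tendsto_nat_tsum a))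

/-! ### Void probability of the cluster process -/

section Cluster

variable {Ω : Type*} [MeasurableSpace Ω] {P : Measure Ω} [IsProbabilityMeasure P]
  {parent : PointProcess Ω Plane} {daughter : ℕ → PointProcess Ω Plane} {lp m rd : ℝ}

/-- Intensity measure of one daughter process. -/
noncomputable def daughterIntensity (m rd : ℝ) : Measure Plane :=
  ENNReal.ofReal (m / (Real.pi * rd ^ 2)) •
    (volume : Measure Plane).restrict (Metric.closedBall 0 rd)

instance isFiniteMeasure_daughterIntensity : IsFiniteMeasure (daughterIntensity m rd) := by
  refine ⟨?_⟩
  rw [daughterIntensity, Measure.smul_apply, Measure.restrict_apply_univ, smul_eq_mul]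
  exact ENNReal.mul_lt_top ENNReal.ofReal_lt_top measure_closedBall_lt_top

lemma daughterIntensity_closedBall (x : Plane) (r : ℝ) :
    daughterIntensity m rd (Metric.closedBall (-x) r) = ENNReal.ofReal (m / (Real.pi * rd ^ 2)) *
      volume (Metric.closedBall (-x) r ∩ Metric.closedBall 0 rd) := by
  rw [daughterIntensity, Measure.smul_apply, smul_eq_mul,
    Measure.restrict_apply Metric.isClosed_closedBall.measurableSet]

lemma measurableSet_dist_neg_le (r : ℝ) :
    MeasurableSet {q : Plane × Plane | q.2 ∈ Metric.closedBall (-q.1) r} := by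
  have : IsClosed {q : Plane × Plane | dist q.2 (-q.1) ≤ r} :=
    isClosed_le (by fun_prop) continuous_const
  exact this.measurableSet

lemma measurable_daughterIntensity_closedBall (r : ℝ) :
    Measurable fun x : Plane => daughterIntensity m rd (Metric.closedBall (-x) r) :=
  measurable_measure_prodMk_left (measurableSet_dist_neg_le r)

lemma daughterIntensity_closedBall_eq_zero {x : Plane} {r : ℝ} (h : r + rd < ‖x‖) :
    daughterIntensity m rd (Metric.closedBall (-x) r) = 0 := by
  rw [daughterIntensity_closedBall, (Metric.closedBall_disjoint_closedBall (by simpa)).inter_eq]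
  simp

/-- The void probability of the cluster process on a disc. -/
theorem IsMaternCluster.measure_void (h : IsMaternCluster parent daughter lp m rd P) (r : ℝ) :
    P {ω | ∀ z ∈ clusterPoints parent daughter ω, z ∉ Metric.closedBall 0 r} =
      expNeg (ENNReal.ofReal lp *
        ∫⁻ x : Plane, (1 - expNeg (daughterIntensity m rd (Metric.closedBall (-x) r)))) := by
  classical
  -- The finiteness premise makes `M` measurable and costs nothing, since daughter counts are almost
  -- surely finite.
  set M : Set (Plane × Measure Plane) :=
    {p | p.2 Set.univ ≠ ∞ → p.2 (Metric.closedBall (-p.1) r) = 0} with hM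
  have hMm : MeasurableSet M := measurableSet_section_null (measurableSet_dist_neg_le r)
  set g : Plane → ℝ≥0∞ := fun x => daughterIntensity m rd (Metric.closedBall (-x) r) with hg
  have hgm : Measurable g := measurable_daughterIntensity_closedBall r
  set X : Ω → ℕ∞ × (ℕ → Plane) := fun ω => (parent.num ω, fun i => parent.pt i ω) with hX
  set D : Ω → ℕ → Measure Plane := fun ω i => (daughter i).count ω with hD
  have hXm : Measurable X :=
    parent.measurable_num.prodMk (measurable_pi_lambda _ parent.measurable_pt)
  have hDm : Measurable D := measurable_pi_lambda _ fun i => (daughter i).measurable_count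
  have hfin : ∀ i, ∀ᵐ ω ∂P, D ω i Set.univ ≠ ∞ := fun i =>
    (h.daughter_poisson i).ae_count_ne_top MeasurableSet.univ
      (measure_ne_top (daughterIntensity m rd) _)
  have hball : ∀ (x : Plane), MeasurableSet (Metric.closedBall x r) := fun x =>
    Metric.isClosed_closedBall.measurableSet
  set S : Set ((ℕ∞ × (ℕ → Plane)) × (ℕ → Measure Plane)) :=
    {p | ∀ i : ℕ, (i : ℕ∞) < p.1.1 → (p.1.2 i, p.2 i) ∈ M} with hS
  have hSm : MeasurableSet S := by
    rw [hS, Set.ofPred_forall]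
    refine MeasurableSet.iInter fun i => MeasurableSet.imp ?_ ?_
    · exact (measurable_fst.comp measurable_fst)
        (Set.to_countable (Set.Ioi (i : ℕ∞))).measurableSet
    · exact (((measurable_pi_apply i).comp (measurable_snd.comp measurable_fst)).prodMk
        ((measurable_pi_apply i).comp measurable_snd)) hMm
  have hvoid : {ω | ∀ z ∈ clusterPoints parent daughter ω, z ∉ Metric.closedBall 0 r} =ᵐ[P]
      {ω | (X ω, D ω) ∈ S} := by
    filter_upwards [ae_all_iff.2 hfin] with ω hω
    refine propext ?_
    have e : (∀ z ∈ clusterPoints parent daughter ω, z ∉ Metric.closedBall 0 r) ↔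
        ∀ i : ℕ, (i : ℕ∞) < parent.num ω → (parent.pt i ω, D ω i) ∈ M := by
      have key : ∀ i : ℕ, (parent.pt i ω, D ω i) ∈ M ↔
          ∀ y ∈ (daughter i).points ω, parent.pt i ω + y ∉ Metric.closedBall 0 r := by
        intro i
        have : (parent.pt i ω, D ω i) ∈ M ↔
            (daughter i).count ω (Metric.closedBall (-parent.pt i ω) r) = 0 :=
          ⟨fun hh => hh (hω i), fun hh _ => hh⟩
        rw [this, PointProcess.count_eq_zero_iff _ _ (hball _)]
        simp only [PointProcess.points, Set.mem_ofPred_eq, Metric.mem_closedBall, dist_eq_norm,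
          sub_neg_eq_add, sub_zero]
        constructor
        · rintro hh y ⟨j, hj, rfl⟩
          rw [add_comm]
          exact hh j hj
        · intro hh j hj
          rw [add_comm]
          exact hh _ ⟨j, hj, rfl⟩
      simp only [key, clusterPoints, Set.mem_ofPred_eq]
      constructor
      · intro hh i hi y hy
        exact hh _ ⟨i, hi, y, hy, rfl⟩
      · rintro hh z ⟨i, hi, y, hy, rfl⟩
        exact hh i hi y hy
    exact e
  -- Parents frozen at `a`: indices beyond the number of parents give the sure event, hence the
  -- summand 0.
  have hsec : ∀ a : ℕ∞ × (ℕ → Plane), (P.map D) (Prod.mk a ⁻¹' S) =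
      expNeg (∑' i : ℕ, if (i : ℕ∞) < a.1 then g (a.2 i) else 0) := by
    intro a
    rw [Measure.map_apply hDm (measurable_prodMk_left hSm)]
    have hsect : ∀ x : Plane, MeasurableSet {μ | (x, μ) ∈ M} := fun x =>
      measurable_prodMk_left hMm
    refine measure_forall_mem_of_iIndepFun h.indep_daughters
      (fun i => (daughter i).measurable_count)
      (A := fun i => {μ | (i : ℕ∞) < a.1 → (a.2 i, μ) ∈ M})
      (fun i => MeasurableSet.imp (MeasurableSet.const _) (hsect _)) fun i => ?_
    by_cases hi : (i : ℕ∞) < a.1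
    · rw [if_pos hi]
      refine Eq.trans (measure_congr ?_) ((h.daughter_poisson i).measure_count_eq_zero
        (hball (-a.2 i)) (measure_ne_top (daughterIntensity m rd) _))
      filter_upwards [hfin i] with ω hω
      refine propext ⟨fun hh => hh hi hω, fun hh _ _ => hh⟩
    · rw [if_neg hi, expNeg_zero]
      simp [hi]
  -- Independence makes the joint law a product, so Fubini integrates the frozen-parent probability
  -- over the parents.
  have hpre : P {ω | (X ω, D ω) ∈ S} = ∫⁻ ω, expNeg (∫⁻ x, g x ∂(parent.count ω)) ∂P := by
    have e : {ω | (X ω, D ω) ∈ S} = (fun ω => (X ω, D ω)) ⁻¹' S := rfl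
    rw [e, ← Measure.map_apply (hXm.prodMk hDm) hSm,
      (indepFun_iff_map_prod_eq_prod_map_map hXm.aemeasurable hDm.aemeasurable).1 h.indep_parent,
      Measure.prod_apply hSm, lintegral_map (measurable_measure_prodMk_left hSm) hXm]
    refine lintegral_congr fun ω => ?_
    rw [hsec, parent.lintegral_count ω hgm]
  rw [measure_congr hvoid, hpre, h.parent_poisson.lintegral_expNeg hgm, lintegral_smul_measure,
    smul_eq_mul]
  -- The Laplace functional requires `g` to have support of finite intensity.
  refine ((measure_mono (t := Metric.closedBall 0 (r + rd)) fun x hx => ?_).trans_lt ?_).ne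
  · by_contra hx'
    rw [mem_closedBall_zero_iff, not_le] at hx'
    exact hx (daughterIntensity_closedBall_eq_zero hx')
  · rw [Measure.smul_apply, smul_eq_mul]
    exact ENNReal.mul_lt_top ENNReal.ofReal_lt_top measure_closedBall_lt_top

end Cluster

/-! ### Area estimates for the lens -/

section Lens

variable {r rd : ℝ} {y : Plane}

lemma volume_closedBall_plane (x : Plane) {s : ℝ} (hs : 0 ≤ s) :
    volume (Metric.closedBall x s) = ENNReal.ofReal (Real.pi * s ^ 2) := by
  rw [EuclideanSpace.volume_closedBall_fin_two, ← ENNReal.ofReal_pow hs,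
    ← ENNReal.ofReal_mul (by positivity), mul_comm]

/-- The smaller disc lies inside the larger one. -/
lemma volume_lens_of_norm_le (hr : 0 < r) (hrd : 0 < rd) (h : ‖y‖ ≤ |r - rd|) :
    volume (Metric.closedBall y r ∩ Metric.closedBall 0 rd) =
      ENNReal.ofReal (Real.pi * betaMin r rd ^ 2) := by
  rcases le_total r rd with hle | hle
  · rw [abs_of_nonpos (by linarith)] at h
    rw [Set.inter_eq_left.2, betaMin, min_eq_left hle, volume_closedBall_plane _ hr.le]
    exact Metric.closedBall_subset_closedBall' (by rw [dist_zero_right]; linarith)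
  · rw [abs_of_nonneg (by linarith)] at h
    rw [Set.inter_eq_right.2, betaMin, min_eq_right hle, volume_closedBall_plane _ hrd.le]
    exact Metric.closedBall_subset_closedBall' (by rw [dist_zero_left]; linarith)

lemma exists_unit_smul_eq (y : Plane) : ∃ u : Plane, ‖u‖ = 1 ∧ y = ‖y‖ • u := by
  rcases eq_or_ne y 0 with rfl | hy
  · obtain ⟨u, hu⟩ := exists_norm_eq Plane zero_le_one
    exact ⟨u, hu, by simp⟩
  · refine ⟨‖y‖⁻¹ • y, norm_smul_inv_norm hy, ?_⟩
    rw [smul_smul, mul_inv_cancel₀ (norm_ne_zero_iff.2 hy), one_smul]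

/-- The lens contains the disc whose diameter is the width of the lens. -/
lemma le_volume_lens (h1 : |r - rd| ≤ ‖y‖) (h2 : ‖y‖ ≤ r + rd) :
    ENNReal.ofReal (Real.pi * ((r + rd - ‖y‖) / 2) ^ 2) ≤
      volume (Metric.closedBall y r ∩ Metric.closedBall 0 rd) := by
  obtain ⟨u, hu, hy⟩ := exists_unit_smul_eq y
  set t := ‖y‖ with ht
  have h3 := abs_le.1 h1
  -- Along the axis through `0` and `y` the lens occupies `[t - r, rd]`; the centre is the midpoint
  -- of this segment.
  rw [← volume_closedBall_plane (((t - r + rd) / 2) • u) (by linarith)]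
  refine measure_mono (Set.subset_inter (Metric.closedBall_subset_closedBall' ?_)
    (Metric.closedBall_subset_closedBall' ?_))
  · rw [hy, dist_eq_norm, ← sub_smul, norm_smul, hu, mul_one, Real.norm_eq_abs,
      abs_of_nonpos (by linarith)]
    linarith
  · rw [dist_zero_right, norm_smul, hu, mul_one, Real.norm_eq_abs]
    have : |(t - r + rd) / 2| ≤ rd - (r + rd - t) / 2 := abs_le.2 ⟨by linarith, by linarith⟩
    linarith

/-- The lens is contained in a rectangle. -/
lemma volume_lens_le (h2 : ‖y‖ ≤ r + rd) :
    volume (Metric.closedBall y r ∩ Metric.closedBall 0 rd) ≤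
      ENNReal.ofReal (2 * betaMin r rd * (r + rd - ‖y‖)) := by
  obtain ⟨u, hu, hy⟩ := exists_unit_smul_eq y
  set t := ‖y‖ with ht
  -- Rotate so that the first axis points along `y`. The first coordinate then lies in `[t - r,
  -- rd]`, and the second is bounded by both radii, hence by `β`.
  obtain ⟨b, hb⟩ := Orthonormal.exists_orthonormalBasis_extension_of_card_eq (𝕜 := ℝ)
    (E := Plane) (ι := Fin 2) (by simp) (v := fun _ => u) (s := {0}) (by
      refine ⟨fun i => hu, fun i j hij => ?_⟩
      exact absurd (Subsingleton.elim i j) hij)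
  have hb0 : b 0 = u := hb 0 rfl
  have hy0 : b.repr y 0 = t := by
    rw [hy, ← hb0, map_smul, b.repr_self]; simp
  have hy1 : b.repr y 1 = 0 := by
    rw [hy, ← hb0, map_smul, b.repr_self]; simp
  have hmp := (EuclideanSpace.volume_preserving_symm_measurableEquiv_toLp (Fin 2)).comp
    b.measurePreserving_repr
  have hcoord : ∀ (z : Plane) (i : Fin 2), |b.repr z i| ≤ ‖z‖ := fun z i => by
    rw [← b.repr.norm_map z]; exact PiLp.norm_apply_le (b.repr z) i
  set lo : Fin 2 → ℝ := ![t - r, -betaMin r rd]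
  set hi : Fin 2 → ℝ := ![rd, betaMin r rd]
  have hsub : Metric.closedBall y r ∩ Metric.closedBall 0 rd ⊆
      ((MeasurableEquiv.toLp 2 (Fin 2 → ℝ)).symm ∘ b.repr) ⁻¹' Set.Icc lo hi := by
    rintro z ⟨hz1, hz2⟩
    rw [mem_closedBall_iff_norm] at hz1
    rw [mem_closedBall_zero_iff] at hz2
    have a0 := abs_le.1 ((hcoord (z - y) 0).trans hz1)
    have a1 := (hcoord (z - y) 1).trans hz1
    have c0 := abs_le.1 ((hcoord z 0).trans hz2)
    have c1 := (hcoord z 1).trans hz2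
    simp only [map_sub, PiLp.sub_apply, hy0, hy1, sub_zero] at a0 a1
    have d1 := abs_le.1 (le_min a1 c1)
    have key : ∀ i, lo i ≤ b.repr z i ∧ b.repr z i ≤ hi i := by
      intro i
      fin_cases i
      · exact ⟨by simp only [lo]; simpa using by linarith, c0.2⟩
      · exact d1
    exact ⟨fun i => (key i).1, fun i => (key i).2⟩
  refine (measure_mono hsub).trans ?_
  rw [hmp.measure_preimage measurableSet_Icc.nullMeasurableSet, Real.volume_Icc_pi,
    Fin.prod_univ_two]
  simp only [lo, hi, Matrix.cons_val_zero, Matrix.cons_val_one]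
  rw [mul_comm, ← ENNReal.ofReal_mul' (by linarith)]
  refine ENNReal.ofReal_le_ofReal (le_of_eq ?_)
  ring

end Lens

/-! ### The error function and two explicit integrals -/

section ErrorFunction

lemma hasDerivAt_erf (x : ℝ) : HasDerivAt erf (2 / √Real.pi * Real.exp (-x ^ 2)) x := by
  have hc : Continuous fun t : ℝ => Real.exp (-t ^ 2) := by fun_prop
  exact (intervalIntegral.integral_hasDerivAt_right (hc.intervalIntegrable _ _)
    hc.stronglyMeasurable.stronglyMeasurableAtFilter hc.continuousAt).const_mul _

lemma erf_zero : erf 0 = 0 := by simp [erf]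

lemma erf_neg (x : ℝ) : erf (-x) = -erf x := by
  have h := intervalIntegral.integral_comp_neg (a := 0) (b := x) fun t : ℝ => Real.exp (-t ^ 2)
  simp only [neg_zero, neg_sq] at h
  rw [erf, erf, h, intervalIntegral.integral_symm (-x) 0]
  ring

lemma integral_sub_mul_exp_neg (b c k : ℝ) (hk : k ≠ 0) :
    ∫ s in (0 : ℝ)..c, (b - s) * Real.exp (-(k * s)) =
      (k * (b - (b - c) * Real.exp (-(k * c))) - 1 + Real.exp (-(k * c))) / k ^ 2 := by
  have hd : ∀ s ∈ Set.uIcc 0 c, HasDerivAt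
      (fun s => Real.exp (-(k * s)) * (1 / k ^ 2 - (b - s) / k))
      ((b - s) * Real.exp (-(k * s))) s := by
    intro s _
    have h1 : HasDerivAt (fun s : ℝ => Real.exp (-(k * s))) (Real.exp (-(k * s)) * (-(k * 1))) s :=
      (((hasDerivAt_id s).const_mul k).neg).exp
    have h2 : HasDerivAt (fun s : ℝ => 1 / k ^ 2 - (b - s) / k) (-((-1) / k)) s :=
      (((hasDerivAt_id s).const_sub b).div_const k).const_sub _
    convert! h1.mul h2 using 1
    field_simp
    ring
  rw [intervalIntegral.integral_eq_sub_of_hasDerivAt hd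
    (Continuous.intervalIntegrable (by fun_prop) _ _)]
  simp only [mul_zero, neg_zero, Real.exp_zero]
  field_simp
  ring

/-- The constant part of `b - s` integrates to `erf`, the linear part to a Gaussian. Here `s / 2` is
the radius of the inscribed disc. -/
lemma integral_sub_mul_exp_neg_sq (b c l : ℝ) (hl : 0 < l) :
    ∫ s in (0 : ℝ)..(2 * c), (b - s) * Real.exp (-(l * (Real.pi * (s / 2) ^ 2))) =
      b * erf (√(l * Real.pi) * c) / √l +
        2 / (l * Real.pi) * (Real.exp (-(l * Real.pi * c ^ 2)) - 1) := by
  have hπ := Real.pi_pos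
  have hsl : 0 < √l := Real.sqrt_pos.2 hl
  have hsπ : 0 < √Real.pi := Real.sqrt_pos.2 hπ
  have hsq : √(l * Real.pi) = √l * √Real.pi := Real.sqrt_mul hl.le _
  have e1 : √l ^ 2 = l := Real.sq_sqrt hl.le
  have e2 : √Real.pi ^ 2 = Real.pi := Real.sq_sqrt hπ.le
  have hd : ∀ s ∈ Set.uIcc 0 (2 * c), HasDerivAt
      (fun s => b / √l * erf (√(l * Real.pi) * (s / 2)) +
        2 / (l * Real.pi) * Real.exp (-(l * (Real.pi * (s / 2) ^ 2))))
      ((b - s) * Real.exp (-(l * (Real.pi * (s / 2) ^ 2)))) s := by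
    intro s _
    have hs : HasDerivAt (fun s : ℝ => s / 2) (1 / 2) s := (hasDerivAt_id s).div_const 2
    have h1 : HasDerivAt (fun s : ℝ => erf (√(l * Real.pi) * (s / 2)))
        (2 / √Real.pi * Real.exp (-(√(l * Real.pi) * (s / 2)) ^ 2) *
          (√(l * Real.pi) * (1 / 2))) s :=
      HasDerivAt.comp (h₂ := erf) s (hasDerivAt_erf (√(l * Real.pi) * (s / 2)))
        (hs.const_mul (√(l * Real.pi)))
    have h2 : HasDerivAt (fun s : ℝ => Real.exp (-(l * (Real.pi * (s / 2) ^ 2))))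
        (Real.exp (-(l * (Real.pi * (s / 2) ^ 2))) *
          (-(l * (Real.pi * (2 * (s / 2) * (1 / 2)))))) s := by
      have := ((((hs.pow 2).const_mul Real.pi).const_mul l).neg).exp
      simpa using! this
    have e3 : -(√(l * Real.pi) * (s / 2)) ^ 2 = -(l * (Real.pi * (s / 2) ^ 2)) := by
      rw [mul_pow, Real.sq_sqrt (by positivity)]; ring
    rw [e3] at h1
    convert! (h1.const_mul (b / √l)).add (h2.const_mul (2 / (l * Real.pi))) using 1
    rw [hsq]
    field_simp
    ring
  rw [intervalIntegral.integral_eq_sub_of_hasDerivAt hd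
    (Continuous.intervalIntegrable (by fun_prop) _ _)]
  have e4 : 2 * c / 2 = c := by ring
  have e5 : l * (Real.pi * c ^ 2) = l * Real.pi * c ^ 2 := by ring
  simp only [e4, e5, zero_div, mul_zero, erf_zero]
  simp
  ring

end ErrorFunction

/-! ### Integration of radial profiles -/

section RadialIntegral

/-- A radial profile: constant on `t ≤ |r - rd|`, and `1 - exp (-ψ (r + rd - t))` on the annulus
`|r - rd| < t ≤ r + rd`. -/
noncomputable def annularProfile (r rd e : ℝ) (ψ : ℝ → ℝ) (t : ℝ) : ℝ :=
  if t ≤ |r - rd| then 1 - e else if t ≤ r + rd then 1 - Real.exp (-ψ (r + rd - t)) else 0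

variable {r rd e : ℝ} {ψ : ℝ → ℝ}

/-- At the inner edge of the annulus the lens width is the smaller diameter, which is the upper
limit after substituting `s = r + rd - t`. -/
lemma add_sub_abs_sub (r rd : ℝ) : r + rd - |r - rd| = 2 * betaMin r rd := by
  rcases le_total r rd with h | h
  · rw [betaMin, min_eq_left h, abs_of_nonpos (by linarith)]; ring
  · rw [betaMin, min_eq_right h, abs_of_nonneg (by linarith)]; ring

lemma measurable_annularProfile (hψ : Continuous ψ) : Measurable (annularProfile r rd e ψ) :=
  Measurable.ite measurableSet_Iic measurable_const
    (Measurable.ite measurableSet_Iic (Continuous.measurable (by fun_prop)) measurable_const)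

lemma annularProfile_nonneg (he : e ≤ 1) (hψ : ∀ s, 0 ≤ s → 0 ≤ ψ s) (t : ℝ) :
    0 ≤ annularProfile r rd e ψ t := by
  unfold annularProfile
  split_ifs with h1 h2
  · linarith
  · have := Real.exp_le_one_iff.2 (neg_nonpos.2 (hψ (r + rd - t) (by linarith)))
    linarith
  · exact le_rfl

lemma annularProfile_le_one (he : 0 ≤ e) (t : ℝ) : annularProfile r rd e ψ t ≤ 1 := by
  unfold annularProfile
  split_ifs with h1 h2
  · linarith
  · linarith [Real.exp_pos (-ψ (r + rd - t))]
  · exact zero_le_one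

lemma integrable_annularProfile_norm (hr : 0 < r) (hrd : 0 < rd) (he : 0 ≤ e) (he1 : e ≤ 1)
    (hψc : Continuous ψ) (hψ : ∀ s, 0 ≤ s → 0 ≤ ψ s) :
    Integrable fun x : Plane => annularProfile r rd e ψ ‖x‖ := by
  have hm : Measurable fun x : Plane => annularProfile r rd e ψ ‖x‖ :=
    (measurable_annularProfile hψc).comp measurable_norm
  have hon : IntegrableOn (fun x : Plane => annularProfile r rd e ψ ‖x‖)
      (Metric.closedBall 0 (r + rd)) :=
    Measure.integrableOn_of_bounded (M := 1) measure_closedBall_lt_top.ne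
      hm.aestronglyMeasurable (ae_of_all _ fun x => by
        rw [Real.norm_eq_abs, abs_of_nonneg (annularProfile_nonneg he1 hψ _)]
        exact annularProfile_le_one he _)
  refine (integrableOn_iff_integrable_of_support_subset fun x hx => ?_).1 hon
  by_contra h
  rw [mem_closedBall_zero_iff, not_le] at h
  have h1 : ¬ ‖x‖ ≤ |r - rd| := not_le.2 ((abs_le.2 ⟨by linarith, by linarith⟩).trans_lt h)
  exact hx (by simp [annularProfile, h1, h.not_ge])

/-- Polar coordinates give `2π ∫ t f(t) dt`. The inner disc yields the `(r - rd)²` term, and `4 r rd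
= (r + rd)² - (r - rd)²` comes from the constant 1 on the annulus. -/
lemma integral_annularProfile_norm (hr : 0 < r) (hrd : 0 < rd) (hψc : Continuous ψ) :
    ∫ x : Plane, annularProfile r rd e ψ ‖x‖ =
      Real.pi * ((r - rd) ^ 2 * (1 - e) + 4 * r * rd -
        2 * ∫ s in (0 : ℝ)..(2 * betaMin r rd), (r + rd - s) * Real.exp (-ψ s)) := by
  have hball : (volume : Measure Plane).real (Metric.ball 0 1) = Real.pi := by
    rw [Measure.real, EuclideanSpace.volume_ball_fin_two]
    simp [Real.pi_pos.le]
  have ha : 0 ≤ |r - rd| := abs_nonneg _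
  have hab : |r - rd| ≤ r + rd := abs_le.2 ⟨by linarith, by linarith⟩
  have hc1 : Continuous fun t : ℝ => t * (1 - e) := by fun_prop
  have hc2 : Continuous fun t : ℝ => t * (1 - Real.exp (-ψ (r + rd - t))) := by fun_prop
  have hc3 : Continuous fun t : ℝ => t * Real.exp (-ψ (r + rd - t)) := by fun_prop
  have hint : ∫ t in Set.Ioi (0 : ℝ), t * annularProfile r rd e ψ t =
      (∫ t in (0 : ℝ)..|r - rd|, t * (1 - e)) +
        ∫ t in |r - rd|..(r + rd), t * (1 - Real.exp (-ψ (r + rd - t))) := by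
    have e1 : ∀ t ∈ Set.Ioc (0 : ℝ) |r - rd|, t * annularProfile r rd e ψ t = t * (1 - e) := by
      intro t ht
      simp [annularProfile, ht.2]
    have e2 : ∀ t ∈ Set.Ioc |r - rd| (r + rd), t * annularProfile r rd e ψ t =
        t * (1 - Real.exp (-ψ (r + rd - t))) := by
      intro t ht
      simp [annularProfile, ht.2, not_le.2 ht.1]
    have e3 : ∀ t ∈ Set.Ioi (r + rd), t * annularProfile r rd e ψ t = 0 := by
      intro t ht
      simp [annularProfile, not_le.2 (hab.trans_lt (Set.mem_Ioi.1 ht)), not_le.2 (Set.mem_Ioi.1 ht)]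
    have i1 : IntegrableOn (fun t => t * annularProfile r rd e ψ t) (Set.Ioc 0 |r - rd|) :=
      (hc1.integrableOn_Ioc).congr_fun (fun t ht => (e1 t ht).symm) measurableSet_Ioc
    have i2 : IntegrableOn (fun t => t * annularProfile r rd e ψ t) (Set.Ioc |r - rd| (r + rd)) :=
      (hc2.integrableOn_Ioc).congr_fun (fun t ht => (e2 t ht).symm) measurableSet_Ioc
    have i3 : IntegrableOn (fun t => t * annularProfile r rd e ψ t) (Set.Ioi (r + rd)) :=
      integrableOn_zero.congr_fun (fun t ht => (e3 t ht).symm) measurableSet_Ioi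
    rw [intervalIntegral.integral_of_le ha, intervalIntegral.integral_of_le hab,
      ← setIntegral_congr_fun measurableSet_Ioc e1, ← setIntegral_congr_fun measurableSet_Ioc e2,
      ← Set.Ioc_union_Ioi_eq_Ioi ha, ← Set.Ioc_union_Ioi_eq_Ioi hab,
      setIntegral_union (by
        rw [Set.Ioc_union_Ioi_eq_Ioi hab]; exact Set.Ioc_disjoint_Ioi le_rfl)
        (measurableSet_Ioc.union measurableSet_Ioi) i1 (i2.union i3),
      setIntegral_union (Set.Ioc_disjoint_Ioi le_rfl) measurableSet_Ioi i2 i3,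
      setIntegral_congr_fun measurableSet_Ioi e3]
    simp
  have hsub : ∫ t in |r - rd|..(r + rd), t * Real.exp (-ψ (r + rd - t)) =
      ∫ s in (0 : ℝ)..(2 * betaMin r rd), (r + rd - s) * Real.exp (-ψ s) := by
    have := intervalIntegral.integral_comp_sub_left (a := |r - rd|) (b := r + rd)
      (fun s => (r + rd - s) * Real.exp (-ψ s)) (r + rd)
    rw [sub_self, add_sub_abs_sub] at this
    rw [← this]
    refine intervalIntegral.integral_congr fun t _ => ?_
    simp only [sub_sub_cancel]
  have hsplit : ∫ t in |r - rd|..(r + rd), t * (1 - Real.exp (-ψ (r + rd - t))) =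
      ((r + rd) ^ 2 - |r - rd| ^ 2) / 2 -
        ∫ s in (0 : ℝ)..(2 * betaMin r rd), (r + rd - s) * Real.exp (-ψ s) := by
    rw [← hsub, ← integral_id, ← intervalIntegral.integral_sub
      (continuous_id'.intervalIntegrable _ _) (hc3.intervalIntegrable _ _)]
    refine intervalIntegral.integral_congr fun t _ => ?_
    simp only [mul_sub, mul_one]
  rw [integral_fun_norm_addHaar, hball, finrank_euclideanSpace_fin]
  simp only [Nat.add_one_sub_one, pow_one, smul_eq_mul, nsmul_eq_mul, Nat.cast_ofNat]
  rw [hint, hsplit, intervalIntegral.integral_mul_const, integral_id, sq_abs]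
  ring

end RadialIntegral

/-! ### Bounds on the integrated hitting probability -/

section Bounds

variable {r rd l : ℝ}

lemma one_sub_expNeg_ofReal {x : ℝ} (hx : 0 ≤ x) :
    1 - expNeg (ENNReal.ofReal x) = ENNReal.ofReal (1 - Real.exp (-x)) := by
  rw [expNeg_ofReal hx, ENNReal.ofReal_sub _ (Real.exp_pos _).le, ENNReal.ofReal_one]

lemma one_sub_expNeg_mono {s t : ℝ≥0∞} (h : s ≤ t) : 1 - expNeg s ≤ 1 - expNeg t :=
  tsub_le_tsub_left (expNeg_antitone h) 1

/-- Probability that a cluster with parent at `x` hits the disc of radius `r`. -/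
noncomputable def hitProb (l r rd : ℝ) (x : Plane) : ℝ≥0∞ :=
  1 - expNeg (ENNReal.ofReal l *
    volume (Metric.closedBall (-x) r ∩ Metric.closedBall 0 rd))

lemma hitProb_of_norm_le (hl : 0 < l) (hr : 0 < r) (hrd : 0 < rd) {x : Plane}
    (h : ‖x‖ ≤ |r - rd|) :
    hitProb l r rd x = ENNReal.ofReal (1 - Real.exp (-(l * Real.pi * betaMin r rd ^ 2))) := by
  have hπ := Real.pi_pos
  rw [hitProb, volume_lens_of_norm_le hr hrd (by rwa [norm_neg]), ← ENNReal.ofReal_mul hl.le,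
    one_sub_expNeg_ofReal (by positivity), mul_assoc]

lemma hitProb_of_lt_norm {x : Plane} (h : r + rd < ‖x‖) : hitProb l r rd x = 0 := by
  rw [hitProb, (Metric.closedBall_disjoint_closedBall (by simpa)).inter_eq]
  simp [expNeg_zero]

lemma betaMin_pos (hr : 0 < r) (hrd : 0 < rd) : 0 < betaMin r rd := lt_min hr hrd

/-- Comparison with the profile of the rectangle area `2βs`. The sign statement lets
`ENNReal.ofReal` be undone exactly in the upper bound. -/
lemma lintegral_hitProb_le (hl : 0 < l) (hr : 0 < r) (hrd : 0 < rd) :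
    0 ≤ Real.pi * (aTerm r rd l - 2 * ∫ s in (0 : ℝ)..(2 * betaMin r rd),
        (r + rd - s) * Real.exp (-(2 * l * betaMin r rd * s))) ∧
    ∫⁻ x, hitProb l r rd x ≤ ENNReal.ofReal (Real.pi * (aTerm r rd l -
      2 * ∫ s in (0 : ℝ)..(2 * betaMin r rd),
        (r + rd - s) * Real.exp (-(2 * l * betaMin r rd * s)))) := by
  have hβ := betaMin_pos hr hrd
  have hπ := Real.pi_pos
  have hψc : Continuous fun s : ℝ => 2 * l * betaMin r rd * s := by fun_prop
  have hψ : ∀ s : ℝ, 0 ≤ s → 0 ≤ 2 * l * betaMin r rd * s := fun s hs => by positivity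
  have he : Real.exp (-(l * Real.pi * betaMin r rd ^ 2)) ≤ 1 :=
    Real.exp_le_one_iff.2 (neg_nonpos.2 (by positivity))
  rw [aTerm, ← integral_annularProfile_norm hr hrd hψc]
  refine ⟨integral_nonneg fun x => annularProfile_nonneg he hψ _, ?_⟩
  rw [ofReal_integral_eq_lintegral_ofReal
    (integrable_annularProfile_norm hr hrd (Real.exp_pos _).le he hψc hψ)
    (ae_of_all _ fun x => annularProfile_nonneg he hψ _)]
  refine lintegral_mono fun x => ?_
  unfold annularProfile
  split_ifs with h1 h2
  · exact (hitProb_of_norm_le hl hr hrd h1).le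
  · rw [← one_sub_expNeg_ofReal (hψ _ (by linarith))]
    refine one_sub_expNeg_mono ?_
    have := volume_lens_le (r := r) (rd := rd) (y := -x) (by rwa [norm_neg])
    rw [norm_neg] at this
    refine (mul_le_mul_right this _).trans (le_of_eq ?_)
    rw [← ENNReal.ofReal_mul hl.le]
    congr 1
    ring
  · exact (hitProb_of_lt_norm (not_le.1 h2)).le.trans bot_le

/-- Comparison with the profile of the inscribed disc area `π (s / 2)²`. -/
lemma le_lintegral_hitProb (hl : 0 < l) (hr : 0 < r) (hrd : 0 < rd) :
    ENNReal.ofReal (Real.pi * (aTerm r rd l -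
      2 * ∫ s in (0 : ℝ)..(2 * betaMin r rd),
        (r + rd - s) * Real.exp (-(l * (Real.pi * (s / 2) ^ 2))))) ≤ ∫⁻ x, hitProb l r rd x := by
  have hβ := betaMin_pos hr hrd
  have hπ := Real.pi_pos
  have hψc : Continuous fun s : ℝ => l * (Real.pi * (s / 2) ^ 2) := by fun_prop
  have hψ : ∀ s : ℝ, 0 ≤ s → 0 ≤ l * (Real.pi * (s / 2) ^ 2) := fun s hs => by positivity
  have he : Real.exp (-(l * Real.pi * betaMin r rd ^ 2)) ≤ 1 :=
    Real.exp_le_one_iff.2 (neg_nonpos.2 (by positivity))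
  rw [aTerm, ← integral_annularProfile_norm hr hrd hψc, ofReal_integral_eq_lintegral_ofReal
    (integrable_annularProfile_norm hr hrd (Real.exp_pos _).le he hψc hψ)
    (ae_of_all _ fun x => annularProfile_nonneg he hψ _)]
  refine lintegral_mono fun x => ?_
  unfold annularProfile
  split_ifs with h1 h2
  · exact (hitProb_of_norm_le hl hr hrd h1).ge
  · rw [← one_sub_expNeg_ofReal (hψ _ (by linarith)), hitProb]
    refine one_sub_expNeg_mono ?_
    have := le_volume_lens (r := r) (rd := rd) (y := -x)
      (by rw [norm_neg]; exact (not_le.1 h1).le) (by rwa [norm_neg])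
    rw [norm_neg] at this
    refine (le_of_eq ?_).trans (mul_le_mul_right this _)
    rw [← ENNReal.ofReal_mul hl.le]
  · simp

end Bounds

/-! ### Capacity functional as a void probability -/

section Capacity

variable {Ω : Type*} [MeasurableSpace Ω] {P : Measure Ω} [IsProbabilityMeasure P]
  {parent : PointProcess Ω Plane} {daughter : ℕ → PointProcess Ω Plane} {lp m rd : ℝ}

/-- Two closed discs meet iff their centres are within the sum of the radii. -/
lemma coveredRegion_inter_closedBall_nonempty_iff (Z : Set Plane) {R s : ℝ} (hR : 0 ≤ R)
    (hs : 0 ≤ s) : (coveredRegion Z R ∩ Metric.closedBall 0 s).Nonempty ↔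
      ∃ z ∈ Z, z ∈ Metric.closedBall (0 : Plane) (R + s) := by
  simp only [coveredRegion, Set.iUnion_inter, Set.nonempty_iUnion, exists_prop]
  refine exists_congr fun z => and_congr_right fun _ => ?_
  rw [← Set.not_disjoint_iff_nonempty_inter, disjoint_closedBall_closedBall_iff hR hs, not_lt,
    Metric.mem_closedBall]

lemma measurableSet_clusterPoints_hit (parent : PointProcess Ω Plane)
    (daughter : ℕ → PointProcess Ω Plane) {B : Set Plane} (hB : MeasurableSet B) :
    MeasurableSet {ω | ∃ z ∈ clusterPoints parent daughter ω, z ∈ B} := by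
  have : {ω | ∃ z ∈ clusterPoints parent daughter ω, z ∈ B} =
      ⋃ i : ℕ, ⋃ j : ℕ, ({ω | (i : ℕ∞) < parent.num ω} ∩ ({ω | (j : ℕ∞) < (daughter i).num ω} ∩
        {ω | parent.pt i ω + (daughter i).pt j ω ∈ B})) := by
    ext ω
    simp only [Set.mem_iUnion, Set.mem_inter_iff, Set.mem_ofPred_eq]
    constructor
    · rintro ⟨z, ⟨i, hi, y, ⟨j, hj, rfl⟩, rfl⟩, hz⟩
      exact ⟨i, j, hi, hj, hz⟩
    · rintro ⟨i, j, hi, hj, hz⟩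
      exact ⟨_, ⟨i, hi, _, ⟨j, hj, rfl⟩, rfl⟩, hz⟩
  rw [this]
  exact MeasurableSet.iUnion fun i => MeasurableSet.iUnion fun j =>
    (parent.measurableSet_lt_num i).inter (((daughter i).measurableSet_lt_num j).inter
      (((parent.measurable_pt i).add ((daughter i).measurable_pt j)) hB))

theorem IsMaternCluster.capacityFunctional_eq (h : IsMaternCluster parent daughter lp m rd P)
    {R rK : ℝ} (hR : 0 ≤ R) (hrK : 0 ≤ rK) :
    capacityFunctional P (fun ω => coveredRegion (clusterPoints parent daughter ω) R)
        (Metric.closedBall 0 rK) =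
      1 - (expNeg (ENNReal.ofReal lp *
        ∫⁻ x, hitProb (m / (Real.pi * rd ^ 2)) (R + rK) rd x)).toReal := by
  have hv := h.measure_void (R + rK)
  simp_rw [daughterIntensity_closedBall] at hv
  have hm := measurableSet_clusterPoints_hit parent daughter
    (Metric.isClosed_closedBall (x := (0 : Plane)) (ε := R + rK)).measurableSet
  have e : {ω | ∀ z ∈ clusterPoints parent daughter ω, z ∉ Metric.closedBall 0 (R + rK)} =
      {ω | ∃ z ∈ clusterPoints parent daughter ω, z ∈ Metric.closedBall 0 (R + rK)}ᶜ := by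
    ext ω
    simp
  rw [e] at hv
  have hc := probReal_compl_eq_one_sub (μ := P) hm
  rw [Measure.real, hv] at hc
  simp_rw [capacityFunctional, coveredRegion_inter_closedBall_nonempty_iff _ hR hrK]
  unfold hitProb
  rw [hc, Measure.real]
  ring

end Capacity

/-! ### Closed forms of the bounds -/

section ClosedForm

variable {lp l r rd : ℝ}

lemma maternUpper_eq (hl : 0 < l) (hr : 0 < r) (hrd : 0 < rd) :
    maternUpper lp l r rd = 1 - Real.exp (-(lp * (Real.pi * (aTerm r rd l -
      2 * ∫ s in (0 : ℝ)..(2 * betaMin r rd),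
        (r + rd - s) * Real.exp (-(2 * l * betaMin r rd * s)))))) := by
  have hβ := betaMin_pos hr hrd
  have habs : r + rd - 2 * betaMin r rd = |r - rd| := by linarith [add_sub_abs_sub r rd]
  have e : 2 * l * betaMin r rd * (2 * betaMin r rd) = 4 * l * betaMin r rd ^ 2 := by ring
  rw [maternUpper, integral_sub_mul_exp_neg _ _ _ (by positivity), habs, e, ← Real.exp_add]
  congr 2
  field_simp
  ring

lemma maternLower_two_eq (hl : 0 < l) :
    maternLower 2 lp l r rd = 1 - Real.exp (-(lp * (Real.pi * (aTerm r rd l -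
      2 * ∫ s in (0 : ℝ)..(2 * betaMin r rd),
        (r + rd - s) * Real.exp (-(l * (Real.pi * (s / 2) ^ 2))))))) := by
  have hπ := Real.pi_pos
  have hsl : 0 < √l := Real.sqrt_pos.2 hl
  have e1 : √l ^ 2 = l := Real.sq_sqrt hl.le
  have e2 : ∀ b x : ℝ, b * x / √l = b * x * √l / l := fun b x => by
    rw [div_eq_div_iff hsl.ne' hl.ne', mul_assoc (b * x), ← sq, e1]
  rw [maternLower, integral_sub_mul_exp_neg_sq _ _ _ hl, erf_neg, e2, ← Real.exp_add]
  congr 2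
  field_simp
  ring

/-- The bracket multiplied by `c` equals `l π` times the integral of a nonnegative function, so the
bound decreases in `c`. -/
lemma maternLower_four_le_two (hlp : 0 < lp) (hl : 0 < l) (hr : 0 < r) (hrd : 0 < rd) :
    maternLower 4 lp l r rd ≤ maternLower 2 lp l r rd := by
  have hπ := Real.pi_pos
  have hβ := betaMin_pos hr hrd
  have hsl : 0 < √l := Real.sqrt_pos.2 hl
  have e1 : √l ^ 2 = l := Real.sq_sqrt hl.le
  have hI : 0 ≤ ∫ s in (0 : ℝ)..(2 * betaMin r rd),
      (r + rd - s) * Real.exp (-(l * (Real.pi * (s / 2) ^ 2))) := by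
    refine intervalIntegral.integral_nonneg (by positivity) fun s hs => ?_
    have : 0 ≤ r + rd - s := by
      linarith [hs.2, add_sub_abs_sub r rd, abs_nonneg (r - rd)]
    positivity
  rw [integral_sub_mul_exp_neg_sq _ _ _ hl] at hI
  have hb : 0 ≤ -2 + 2 * Real.exp (-(l * Real.pi * betaMin r rd ^ 2))
      - Real.pi * √l * (r + rd) * erf (-(√(l * Real.pi) * betaMin r rd)) := by
    have := mul_nonneg (mul_pos hl hπ).le hI
    rw [erf_neg]
    refine this.trans (le_of_eq ?_)
    have e2 : ∀ b x : ℝ, b * x / √l = b * x * √l / l := fun b x => by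
      rw [div_eq_div_iff hsl.ne' hl.ne', mul_assoc (b * x), ← sq, e1]
    rw [e2]
    field_simp
    ring
  unfold maternLower
  gcongr
  norm_num

end ClosedForm

/-! ### Return to real numbers and conclusion -/

lemma toReal_expNeg_ofReal {x : ℝ} (hx : 0 ≤ x) :
    (expNeg (ENNReal.ofReal x)).toReal = Real.exp (-x) := by
  rw [expNeg_ofReal hx, ENNReal.toReal_ofReal (Real.exp_pos _).le]

/-- Truncating a negative exponent to 0 only lowers the value, so the lower bound on the capacity
needs no sign check. -/
lemma toReal_expNeg_ofReal_le (x : ℝ) : (expNeg (ENNReal.ofReal x)).toReal ≤ Real.exp (-x) := by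
  rcases le_total 0 x with hx | hx
  · exact (toReal_expNeg_ofReal hx).le
  · rw [ENNReal.ofReal_of_nonpos hx, expNeg_zero, ENNReal.toReal_one]
    exact Real.one_le_exp (by linarith)

lemma expNeg_ne_top (t : ℝ≥0∞) : expNeg t ≠ ∞ :=
  ((expNeg_le_one t).trans_lt ENNReal.one_lt_top).ne

theorem theorem3 {Ω : Type*} [MeasurableSpace Ω] (P : Measure Ω) [IsProbabilityMeasure P]
    (lp m rd R rK : ℝ) (hlp : 0 < lp) (hm : 0 < m) (hrd : 0 < rd) (hR : 0 < R) (hrK : 0 ≤ rK)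
    (parent : PointProcess Ω Plane) (daughter : ℕ → PointProcess Ω Plane)
    (hM : IsMaternCluster parent daughter lp m rd P) :
    capacityFunctional P (fun ω => coveredRegion (clusterPoints parent daughter ω) R)
        (Metric.closedBall 0 rK) ≤ maternUpper lp (m / (Real.pi * rd ^ 2)) (R + rK) rd ∧
    maternLower 2 lp (m / (Real.pi * rd ^ 2)) (R + rK) rd ≤
      capacityFunctional P (fun ω => coveredRegion (clusterPoints parent daughter ω) R)
        (Metric.closedBall 0 rK) ∧
    maternLower 4 lp (m / (Real.pi * rd ^ 2)) (R + rK) rd ≤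
      capacityFunctional P (fun ω => coveredRegion (clusterPoints parent daughter ω) R)
        (Metric.closedBall 0 rK) := by
  have hl : 0 < m / (Real.pi * rd ^ 2) := by have := Real.pi_pos; positivity
  have hr : 0 < R + rK := by linarith
  have hlow : maternLower 2 lp (m / (Real.pi * rd ^ 2)) (R + rK) rd ≤
      capacityFunctional P (fun ω => coveredRegion (clusterPoints parent daughter ω) R)
        (Metric.closedBall 0 rK) := by
    rw [hM.capacityFunctional_eq hR.le hrK, maternLower_two_eq hl]
    refine sub_le_sub_left (le_trans ?_ (toReal_expNeg_ofReal_le _)) 1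
    rw [ENNReal.ofReal_mul hlp.le]
    exact ENNReal.toReal_mono (expNeg_ne_top _)
      (expNeg_antitone (by gcongr; exact le_lintegral_hitProb hl hr hrd))
  refine ⟨?_, hlow, (maternLower_four_le_two hlp hl hr hrd).trans hlow⟩
  obtain ⟨hpos, hle⟩ := lintegral_hitProb_le hl hr hrd
  rw [hM.capacityFunctional_eq hR.le hrK, maternUpper_eq hl hr hrd,
    ← toReal_expNeg_ofReal (mul_nonneg hlp.le hpos), ENNReal.ofReal_mul hlp.le]
  refine sub_le_sub_left (ENNReal.toReal_mono (expNeg_ne_top _) (expNeg_antitone ?_)) 1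
  gcongr
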